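/- An arithmetic polygon is a polygon in the Euclidean plane with $N\ge 3$ vertices, one of which is a distinguished vertex $O$, such that: (1) for some integer $a\ge 0$, when the polygon is traversed (in a suitable direction) starting and finishing at $O$, its sides have lengths $a+1,a+2,\dots,a+N$ in this order; (2) for each side there is a line perpendicular to that side which passes through both $O$ and one of the two end points of that side; (3) no angle of the polygon, including the one at $O$, equals $0$ or $\pi$. A polygon is convex if it is simple (not self-intersecting) and is the boundary of the convex hull of its vertices. For integers $0\le a$, $a+1<b<c$ with $$(a+1)^2+\cdots+b^2=(b+1)^2+\cdots+c^2,$$ an arithmetic polygon is said to come from $(a,b,c)$ if its sides, in order from $O$, have lengths $a+1,\dots,c$, each of the sides of length $a+1,\dots,b$ is perpendicular to the diagonal from $O$ to its first end point, and each of the sides of length $b+1,\dots,c$ is perpendicular to the diagonal from $O$ to its second end point (a diagonal of length zero imposing no condition). **Theorem.** Up to rigid transformations (isometries of the plane, reflections included), there are exactly two convex arithmetic polygons: the $3$-$4$-$5$ triangle, which comes from $(2,4,5)$, and a pentagon with side lengths $10,11,12,13,14$, which comes from $(9,12,14)$. That is, both of these polygons exist and are convex and arithmetic, they are not congruent, and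 every convex arithmetic polygon is congruent to one of them. -/

import Mathlib

open scoped RealInnerProductSpace EuclideanGeometry Affine

/-- The Euclidean plane. -/
abbrev Plane : Type := EuclideanSpace ℝ (Fin 2)

namespace Polygon

/-- The length of the side joining vertex `i` to the next vertex; indices are cyclic, so the last
side returns to vertex `0`. -/
noncomputable def sideLength {n : ℕ} [NeZero n] (P : Polygon Plane n) (i : Fin n) : ℝ :=
  dist (P i) (P (i + 1))

/-- Each side has a perpendicular line passing through the special vertex `O = P 0` and through
one of the two end points of that side. -/
def HasPerpendicularSides {n : ℕ} [NeZero n] (P : Polygon Plane n) : Prop :=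
  ∀ i : Fin n, ∃ l : AffineSubspace ℝ Plane,
    Module.finrank ℝ l.direction = 1 ∧
    l.direction ⟂ (line[ℝ, P i, P (i + 1)]).direction ∧
    P 0 ∈ l ∧ (P i ∈ l ∨ P (i + 1) ∈ l)

/-- An arithmetic polygon. Its vertices are listed in the order in which they are met when the
polygon is traversed from the special vertex `O` along the sides of increasing length, so that `O`
is vertex `0`. The side lengths are consecutive positive integers `a + 1, a + 2, …, a + n`, every
side has the perpendicularity property with respect to `O`, and no angle (including the one at
`O`) is `0` or `π`. -/
structure IsArithmetic {n : ℕ} [NeZero n] (P : Polygon Plane n) : Prop where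
  three_le : 3 ≤ n
  consecutive : ∃ a : ℕ, ∀ i : Fin n, P.sideLength i = (a : ℝ) + 1 + (i : ℕ)
  perpendicular : P.HasPerpendicularSides
  nondegenerate : ∀ i : Fin n,
    ∠ (P i) (P (i + 1)) (P (i + 2)) ≠ 0 ∧ ∠ (P i) (P (i + 1)) (P (i + 2)) ≠ Real.pi

/-- A polygon is simple (not self-intersecting) if its vertices are distinct, consecutive sides
meet only in their common vertex, and sides that are not consecutive are disjoint. -/
structure IsSimple {n : ℕ} [NeZero n] (P : Polygon Plane n) : Prop where
  injective : Function.Injective P.vertices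
  adjacent : ∀ i : Fin n, P.edgeSet ℝ i ∩ P.edgeSet ℝ (i + 1) = {P (i + 1)}
  nonadjacent : ∀ i j : Fin n, j ≠ i → j ≠ i + 1 → i ≠ j + 1 →
    Disjoint (P.edgeSet ℝ i) (P.edgeSet ℝ j)

/-- A polygon is convex if it is simple and is the boundary of a convex region, which is then the
convex hull of its vertices. -/
structure IsConvex {n : ℕ} [NeZero n] (P : Polygon Plane n) : Prop where
  simple : P.IsSimple
  boundary_eq : P.boundary ℝ = frontier (convexHull ℝ (Set.range P.vertices))

/-- The polygon comes from the solution `(a, b, c)` of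
`(a+1)² + ⋯ + b² = (b+1)² + ⋯ + c²`: its sides, in order from `O = P 0`, have lengths
`a + 1, …, c`, each of the sides `a + 1, …, b` is perpendicular to the diagonal from `O` to its
first end point, and each of the sides `b + 1, …, c` is perpendicular to the diagonal from `O` to
its second end point. -/
structure ComesFrom {n : ℕ} [NeZero n] (P : Polygon Plane n) (a b c : ℕ) : Prop where
  lt_b : a + 1 < b
  lt_c : b < c
  sum_eq : ∑ k ∈ Finset.Ioc a b, k ^ 2 = ∑ k ∈ Finset.Ioc b c, k ^ 2
  sides : a + n = c
  length : ∀ i : Fin n, P.sideLength i = (a : ℝ) + 1 + (i : ℕ)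
  first_arm : ∀ i : Fin n, a + 1 + (i : ℕ) ≤ b → ⟪P i - P 0, P (i + 1) - P i⟫ = 0
  second_arm : ∀ i : Fin n, b < a + 1 + (i : ℕ) → ⟪P (i + 1) - P 0, P (i + 1) - P i⟫ = 0

/-- Two polygons are the same up to rigid transformations if an isometry of the plane (reflections
are allowed) carries one onto the other, as figures in the plane. -/
def RigidEquiv {m n : ℕ} (P : Polygon Plane m) (Q : Polygon Plane n) : Prop :=
  ∃ e : Plane ≃ᵢ Plane, e '' P.boundary ℝ = Q.boundary ℝ

end Polygon

/-! Put `O` at the origin and let `q j` be the vertices. Each side not ending at `O` is a leg of a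
right triangle whose other sides are the diagonals to its end points. Two consecutive sides cannot
both be perpendicular to the diagonal at their common vertex, as they would be parallel. Hence there
is an apex `m`: the right angles sit at first end points before it and at second end points from it
on (`exists_apex`). Pythagoras along each arm computes `‖q m‖ ^ 2` twice, which is the equation
between sums of squares (`sum_sq_eq`).

Convexity keeps the polygon on one side of its first side, so the angles at `O` add up to at most
`π` (`sum_arctan_tangent_le`). On the first arm their tangents are at least `1, 1/√2, 1/√3, …`
whatever `a` is, and six such angles already exceed `π`; thus `m ≤ 6`. The Diophantine equation then
has five solutions (`eq_of_sum_sq_eq`), and adding angles of the second arm excludes the three with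
`m ≥ 4`. In the other two cases the right triangles determine every vertex in a frame along the
first side, giving uniqueness up to isometry.

Existence is a computation with explicit coordinates: it suffices that every other vertex lies
strictly to the left of each side (`IsStrictlyLeft.isConvex`). -/

/-! ### Linear algebra in the plane -/

namespace Plane

/-- The determinant of two vectors of the plane. -/
def cross (u v : Plane) : ℝ := u 0 * v 1 - u 1 * v 0

theorem inner_eq (u v : Plane) : ⟪u, v⟫ = u 0 * v 0 + u 1 * v 1 := by
  simp [PiLp.inner_apply, Fin.sum_univ_two, mul_comm]

theorem norm_sq_eq (u : Plane) : ‖u‖ ^ 2 = u 0 ^ 2 + u 1 ^ 2 := by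
  rw [← real_inner_self_eq_norm_sq, inner_eq]; ring

theorem ext_coord {u v : Plane} (h₀ : u 0 = v 0) (h₁ : u 1 = v 1) : u = v := by
  ext i; fin_cases i <;> assumption

theorem sq_add_sq_pos {u : Plane} (hu : u ≠ 0) : 0 < u 0 ^ 2 + u 1 ^ 2 := by
  rw [← norm_sq_eq]; positivity

theorem cross_self (u : Plane) : cross u u = 0 := by simp [cross, mul_comm]

theorem cross_add_right (u v w : Plane) : cross u (v + w) = cross u v + cross u w := by
  simp [cross]; ring

theorem cross_sub_right (u v w : Plane) : cross u (v - w) = cross u v - cross u w := by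
  simp [cross]; ring

theorem cross_smul_right (c : ℝ) (u v : Plane) : cross u (c • v) = c * cross u v := by
  simp [cross]; ring

/-- Lagrange's identity in the plane. -/
theorem cross_sq_add_inner_sq (u v : Plane) :
    cross u v ^ 2 + ⟪u, v⟫ ^ 2 = ‖u‖ ^ 2 * ‖v‖ ^ 2 := by
  rw [norm_sq_eq, norm_sq_eq, inner_eq, cross]; ring

theorem cross_eq_zero_of_inner_eq_zero {u v w : Plane} (hu : u ≠ 0) (hv : ⟪u, v⟫ = 0)
    (hw : ⟪u, w⟫ = 0) : cross v w = 0 := by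
  have h := sq_add_sq_pos hu
  rw [inner_eq] at hv hw
  have : (u 0 ^ 2 + u 1 ^ 2) * cross v w = 0 := by
    rw [cross]
    linear_combination (u 0 * w 1 - u 1 * w 0) * hv + (u 1 * v 0 - u 0 * v 1) * hw
  exact (mul_eq_zero.1 this).resolve_left h.ne'

theorem angle_ne_of_cross_ne_zero {u v : Plane} (h : cross u v ≠ 0) :
    InnerProductGeometry.angle u v ≠ 0 ∧ InnerProductGeometry.angle u v ≠ Real.pi := by
  constructor <;> intro h'
  · obtain ⟨-, r, -, rfl⟩ := InnerProductGeometry.angle_eq_zero_iff.1 h'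
    exact h (by rw [cross_smul_right, cross_self, mul_zero])
  · obtain ⟨-, r, -, rfl⟩ := InnerProductGeometry.angle_eq_pi_iff.1 h'
    exact h (by rw [cross_smul_right, cross_self, mul_zero])

theorem cross_ne_zero_of_angle_ne {u v : Plane} (hu : u ≠ 0) (hv : v ≠ 0)
    (h₀ : InnerProductGeometry.angle u v ≠ 0) (hπ : InnerProductGeometry.angle u v ≠ Real.pi) :
    cross u v ≠ 0 := by
  intro h
  have hpos := sq_add_sq_pos hu
  obtain ⟨r, hr⟩ : ∃ r : ℝ, v = r • u := by
    refine ⟨(u 0 * v 0 + u 1 * v 1) / (u 0 ^ 2 + u 1 ^ 2), ?_⟩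
    rw [cross] at h
    apply ext_coord <;> simp only [PiLp.smul_apply, smul_eq_mul] <;> field_simp
    · linear_combination (-u 1) * h
    · linear_combination (u 0) * h
  rcases lt_trichotomy r 0 with h' | h' | h'
  · exact hπ (InnerProductGeometry.angle_eq_pi_iff.2 ⟨hu, r, h', hr⟩)
  · exact hv (by rw [hr, h', zero_smul])
  · exact h₀ (InnerProductGeometry.angle_eq_zero_iff.2 ⟨hu, r, h', hr⟩)

theorem apply_eq (f : Plane →L[ℝ] ℝ) (v : Plane) :
    f v = f (EuclideanSpace.single 0 1) * v 0 + f (EuclideanSpace.single 1 1) * v 1 := by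
  have : v = v 0 • EuclideanSpace.single 0 1 + v 1 • EuclideanSpace.single 1 1 := by
    apply ext_coord <;> simp
  conv_lhs => rw [this]
  simp [mul_comm]

/-- A linear form which vanishes on `d ≠ 0` is a multiple of `cross d`. -/
theorem exists_apply_eq_mul_cross (f : Plane →L[ℝ] ℝ) {d : Plane} (hd : d ≠ 0) (hf : f d = 0) :
    ∃ c : ℝ, ∀ v, f v = c * cross d v := by
  have h := sq_add_sq_pos hd
  rw [apply_eq f] at hf
  set a := f (EuclideanSpace.single 0 1) with ha
  set b := f (EuclideanSpace.single 1 1) with hb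
  refine ⟨(b * d 0 - a * d 1) / (d 0 ^ 2 + d 1 ^ 2), fun v => ?_⟩
  rw [apply_eq f v, ← ha, ← hb, cross]
  field_simp
  linear_combination (d 0 * v 0 + d 1 * v 1) * hf

theorem eq_zero_of_apply_eq_zero (f : Plane →L[ℝ] ℝ) {u v : Plane} (huv : cross u v ≠ 0)
    (hu : f u = 0) (hv : f v = 0) : f = 0 := by
  have hu0 : u ≠ 0 := by rintro rfl; simp [cross] at huv
  obtain ⟨c, hc⟩ := exists_apply_eq_mul_cross f hu0 hu
  have : c = 0 := by
    have := hc v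
    rw [hv] at this
    exact (mul_eq_zero.1 this.symm).resolve_right huv
  ext w
  simp [hc w, this]

end Plane

/-! ### Supporting hyperplanes -/

/-- A convex set in a finite-dimensional space has a supporting hyperplane at each of its points
that is not interior. -/
theorem Convex.exists_support {E : Type*} [NormedAddCommGroup E] [NormedSpace ℝ E]
    [FiniteDimensional ℝ E] {s : Set E} (hs : Convex ℝ s) {x : E} (hx : x ∈ s)
    (hxi : x ∉ interior s) : ∃ f : E →L[ℝ] ℝ, f ≠ 0 ∧ ∀ y ∈ s, f y ≤ f x := by
  by_cases hne : (interior s).Nonempty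
  · obtain ⟨f, hf⟩ := geometric_hahn_banach_open_point hs.interior isOpen_interior hxi
    refine ⟨f, ?_, fun y hy => ?_⟩
    · rintro rfl
      obtain ⟨y, hy⟩ := hne
      simpa using hf y hy
    · have hy' : y ∈ closure (interior s) := by
        rw [hs.closure_interior_eq_closure_of_nonempty_interior hne]
        exact subset_closure hy
      exact closure_minimal (fun z hz => (hf z hz).le)
        (isClosed_le f.continuous continuous_const) hy'
  -- With empty interior, `s` lies in a proper affine subspace; a nonzero form vanishing on its
  -- direction is constant on `s`.
  · rw [hs.interior_nonempty_iff_affineSpan_eq_top] at hne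
    have hdir : vectorSpan ℝ s < ⊤ := by
      refine lt_top_iff_ne_top.2 fun h => hne ?_
      rwa [← AffineSubspace.direction_eq_top_iff_of_nonempty ⟨x, mem_affineSpan ℝ hx⟩,
        direction_affineSpan]
    obtain ⟨g, hg0, hg⟩ := Submodule.exists_le_ker_of_lt_top _ hdir
    refine ⟨g.toContinuousLinearMap, ?_, fun y hy => ?_⟩
    · intro h
      apply hg0
      ext v
      simpa using congrArg (fun φ => φ v) h
    · have : g (y - x) = 0 := hg (vsub_mem_vectorSpan ℝ hy hx)
      rw [map_sub, sub_eq_zero] at this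
      exact this.le

/-! ### A criterion for convexity of polygons -/

open Plane

namespace Polygon

theorem exists_weights {n : ℕ} (P : Polygon Plane n) {x : Plane}
    (hx : x ∈ convexHull ℝ (Set.range P.vertices)) :
    ∃ w : Fin n → ℝ, (∀ i, 0 ≤ w i) ∧ ∑ i, w i = 1 ∧ ∑ i, w i • P i = x := by
  classical
  rw [convexHull_range_eq_exists_affineCombination] at hx
  obtain ⟨s, w, h0, h1, rfl⟩ := hx
  refine ⟨fun i => if i ∈ s then w i else 0, fun i => ?_, ?_, ?_⟩
  · dsimp only
    split_ifs with h
    exacts [h0 i h, le_rfl]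
  · simpa using h1
  · rw [Finset.affineCombination_eq_linear_combination _ _ _ h1]
    simp [ite_smul, Finset.sum_ite_mem]

theorem isCompact_hull {n : ℕ} (P : Polygon Plane n) :
    IsCompact (convexHull ℝ (Set.range P.vertices)) :=
  (Set.finite_range _).isCompact_convexHull (𝕜 := ℝ)

variable {n : ℕ} [NeZero n]

theorem fin_one_ne_zero (hn : 3 ≤ n) : (1 : Fin n) ≠ 0 := by
  intro h
  have := congrArg Fin.val h
  rw [Fin.val_one', Fin.val_zero, Nat.mod_eq_of_lt (by omega)] at this
  omega

theorem fin_one_add_one_ne_zero (hn : 3 ≤ n) : (1 : Fin n) + 1 ≠ 0 := by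
  intro h
  have := congrArg Fin.val h
  rw [Fin.val_add, Fin.val_one', Fin.val_zero, Nat.mod_eq_of_lt (by omega : 1 < n),
    Nat.mod_eq_of_lt (by omega)] at this
  omega

theorem fin_two_eq : (2 : Fin n) = 1 + 1 := by
  apply Fin.ext
  simp [Fin.val_add]

theorem edgeSet_eq_segment (P : Polygon Plane n) (i : Fin n) :
    P.edgeSet ℝ i = segment ℝ (P i) (P (i + 1)) := by
  rw [edgeSet, finRotate_apply, affineSegment_eq_segment]

theorem edgeSet_subset_convexHull (P : Polygon Plane n) (i : Fin n) :
    P.edgeSet ℝ i ⊆ convexHull ℝ (Set.range P.vertices) := by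
  rw [edgeSet_eq_segment]
  exact segment_subset_convexHull ⟨i, rfl⟩ ⟨i + 1, rfl⟩

/-- A polygon whose interior lies strictly to the left of each of its sides. -/
def IsStrictlyLeft (P : Polygon Plane n) : Prop :=
  ∀ i k : Fin n, k ≠ i → k ≠ i + 1 → 0 < cross (P (i + 1) - P i) (P k - P i)

namespace IsStrictlyLeft

variable {P : Polygon Plane n}

theorem cross_nonneg (h : P.IsStrictlyLeft) (i k : Fin n) :
    0 ≤ cross (P (i + 1) - P i) (P k - P i) := by
  by_cases h₁ : k = i
  · simp [h₁, cross]
  by_cases h₂ : k = i + 1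
  · rw [h₂, cross_self]
  exact (h i k h₁ h₂).le

theorem cross_nonneg_of_mem (h : P.IsStrictlyLeft) (i : Fin n) {x : Plane}
    (hx : x ∈ convexHull ℝ (Set.range P.vertices)) :
    0 ≤ cross (P (i + 1) - P i) (x - P i) := by
  obtain ⟨w, h0, h1, rfl⟩ := exists_weights P hx
  have : cross (P (i + 1) - P i) (∑ k, w k • P k - P i)
      = ∑ k, w k * cross (P (i + 1) - P i) (P k - P i) := by
    have e : ∑ k, w k • P k - P i = ∑ k, w k • (P k - P i) := by
      simp_rw [smul_sub]
      rw [Finset.sum_sub_distrib, ← Finset.sum_smul, h1, one_smul]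
    rw [e]
    generalize P (i + 1) - P i = d
    have : ∀ s : Finset (Fin n), cross d (∑ k ∈ s, w k • (P k - P i))
        = ∑ k ∈ s, w k * cross d (P k - P i) := by
      intro s
      induction s using Finset.cons_induction with
      | empty => simp [cross]
      | cons a s ha ih => rw [Finset.sum_cons, Finset.sum_cons, cross_add_right,
          cross_smul_right, ih]
    exact this _
  rw [this]
  exact Finset.sum_nonneg fun k _ => mul_nonneg (h0 k) (h.cross_nonneg i k)

theorem injective (h : P.IsStrictlyLeft) (hn : 3 ≤ n) : Function.Injective P.vertices := by
  have key : ∀ i j : Fin n, P i = P j → j = i ∨ j = i + 1 := by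
    intro i j hij
    by_contra! hc
    have := h i j hc.1 hc.2
    simp [← hij, cross] at this
  intro i j hij
  by_contra hne
  have h₁ : j = i + 1 := (key i j hij).resolve_left (Ne.symm hne)
  have h₂ : i = j + 1 := (key j i hij.symm).resolve_left hne
  rw [h₁, add_assoc] at h₂
  exact fin_one_add_one_ne_zero hn (by simpa using h₂)

theorem adjacent (h : P.IsStrictlyLeft) (hn : 3 ≤ n) (i : Fin n) :
    P.edgeSet ℝ i ∩ P.edgeSet ℝ (i + 1) = {P (i + 1)} := by
  rw [edgeSet_eq_segment, edgeSet_eq_segment]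
  apply Set.Subset.antisymm
  · rintro x ⟨⟨a, b, ha, hb, hab, rfl⟩, ⟨c, d, hc, hd, hcd, hx⟩⟩
    have hpos := h i (i + 1 + 1)
      (by rw [add_assoc]; simpa using fin_one_add_one_ne_zero hn)
      (by simpa using fin_one_ne_zero hn)
    have e₁ : cross (P (i + 1) - P i) (a • P i + b • P (i + 1) - P i) = 0 := by
      have : a = 1 - b := by linarith
      subst this
      simp [cross]; ring
    rw [← hx] at e₁
    have e₂ : cross (P (i + 1) - P i) (c • P (i + 1) + d • P (i + 1 + 1) - P i)
        = d * cross (P (i + 1) - P i) (P (i + 1 + 1) - P i) := by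
      have : c = 1 - d := by linarith
      subst this
      simp [cross]; ring
    rw [e₂] at e₁
    have hd0 : d = 0 := (mul_eq_zero.1 e₁).resolve_right hpos.ne'
    have hc1 : c = 1 := by linarith
    rw [← hx, hd0, hc1]
    simp
  · rintro x rfl
    exact ⟨right_mem_segment _ _ _, left_mem_segment _ _ _⟩

theorem nonadjacent (h : P.IsStrictlyLeft) (i j : Fin n) (h₁ : j ≠ i) (h₂ : j ≠ i + 1)
    (h₃ : i ≠ j + 1) : Disjoint (P.edgeSet ℝ i) (P.edgeSet ℝ j) := by
  rw [edgeSet_eq_segment, edgeSet_eq_segment, Set.disjoint_left]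
  rintro x ⟨a, b, ha, hb, hab, rfl⟩ ⟨c, d, hc, hd, hcd, hx⟩
  have p₁ := h i j h₁ h₂
  have p₂ := h i (j + 1) (Ne.symm h₃) (by simpa using h₁)
  have e₁ : cross (P (i + 1) - P i) (a • P i + b • P (i + 1) - P i) = 0 := by
    have : a = 1 - b := by linarith
    subst this
    simp [cross]; ring
  have e₂ : cross (P (i + 1) - P i) (c • P j + d • P (j + 1) - P i)
      = c * cross (P (i + 1) - P i) (P j - P i)
        + d * cross (P (i + 1) - P i) (P (j + 1) - P i) := by
    have : c = 1 - d := by linarith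
    subst this
    simp [cross]; ring
  rw [← hx, e₂] at e₁
  rcases hc.eq_or_lt with rfl | hc
  · have : d = 1 := by linarith
    subst this
    linarith
  · linarith [mul_pos hc p₁, mul_nonneg hd p₂.le]

theorem edge_ne_zero (h : P.IsStrictlyLeft) (hn : 3 ≤ n) (i : Fin n) : P (i + 1) - P i ≠ 0 := by
  intro h0
  exact fin_one_ne_zero hn (by simpa using h.injective hn (sub_eq_zero.1 h0))

theorem edgeSet_subset_frontier (h : P.IsStrictlyLeft) (hn : 3 ≤ n) (i : Fin n) :
    P.edgeSet ℝ i ⊆ frontier (convexHull ℝ (Set.range P.vertices)) := by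
  intro x hx
  have hxC := edgeSet_subset_convexHull P i hx
  rw [(isCompact_hull P).isClosed.frontier_eq]
  refine ⟨hxC, fun hint => ?_⟩
  rw [edgeSet_eq_segment] at hx
  obtain ⟨a, b, ha, hb, hab, rfl⟩ := hx
  have hd := sq_add_sq_pos (h.edge_ne_zero hn i)
  set d := P (i + 1) - P i with hdef
  set x := a • P i + b • P (i + 1) with hx
  have e₁ : cross d (x - P i) = 0 := by
    have : a = 1 - b := by linarith
    subst this
    simp [cross, hdef, hx]; ring
  -- This is the outward normal: a small step along it from an interior point would stay in the hull
  -- but cross to the right of the side.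
  let v : Plane := !₂[d 1, - d 0]
  have hcont : Filter.Tendsto (fun t : ℝ => x + t • v) (nhdsWithin 0 (Set.Ioi 0)) (nhds x) := by
    have : Continuous fun t : ℝ => x + t • v := by fun_prop
    simpa using (this.tendsto 0).mono_left (nhdsWithin_le_nhds (s := Set.Ioi 0))
  have hev := hcont.eventually (isOpen_interior.mem_nhds hint)
  obtain ⟨t, ht, htpos⟩ := (hev.and self_mem_nhdsWithin).exists
  have := h.cross_nonneg_of_mem i (interior_subset ht)
  rw [← hdef, add_sub_right_comm, cross_add_right, e₁, cross_smul_right] at this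
  have e₂ : cross d v = -(d 0 ^ 2 + d 1 ^ 2) := by simp [cross, v]; ring
  rw [e₂] at this
  nlinarith [mul_pos (show 0 < t from htpos) hd]

theorem mem_edgeSet_of_weights {w : Fin n → ℝ} (hw : ∀ i, 0 ≤ w i) (hw₁ : ∑ i, w i = 1)
    {i : Fin n} (hne : i ≠ i + 1) (h : ∀ k, k ≠ i → k ≠ i + 1 → w k = 0) :
    ∑ k, w k • P k ∈ P.edgeSet ℝ i := by
  rw [edgeSet_eq_segment]
  refine ⟨w i, w (i + 1), hw _, hw _, ?_, ?_⟩
  · rw [← hw₁]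
    exact (Fintype.sum_eq_add i (i + 1) hne fun k hk => h k hk.1 hk.2).symm
  · refine (Fintype.sum_eq_add (f := fun k => w k • P k) i (i + 1) hne fun k hk => ?_).symm
    rw [h k hk.1 hk.2, zero_smul]

/-- A supporting form at `x` is maximal at every vertex that carries weight in `x`. Fix one such
vertex: any other must be one of its two neighbours, and not both can occur, so `x` lies on a side.
-/
theorem frontier_subset_boundary (h : P.IsStrictlyLeft) (hn : 3 ≤ n) :
    frontier (convexHull ℝ (Set.range P.vertices)) ⊆ P.boundary ℝ := by
  intro x hx
  rw [(isCompact_hull P).isClosed.frontier_eq] at hx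
  obtain ⟨hxC, hxi⟩ := hx
  obtain ⟨g, hg0, hg⟩ := (convex_convexHull ℝ _).exists_support hxC hxi
  obtain ⟨w, hw0, hw1, hwx⟩ := exists_weights P hxC
  have hgP : ∀ k, g (P k) ≤ g x := fun k => hg _ (subset_convexHull ℝ _ ⟨k, rfl⟩)
  have hmax : ∀ k, w k ≠ 0 → g (P k) = g x := by
    have hsum : ∑ k, w k * (g x - g (P k)) = 0 := by
      have : g x = ∑ k, w k * g (P k) := by
        conv_lhs => rw [← hwx]
        simp
      simp_rw [mul_sub]
      rw [Finset.sum_sub_distrib, ← Finset.sum_mul, hw1, one_mul, this, sub_self]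
    intro k hk
    have := (Finset.sum_eq_zero_iff_of_nonneg fun k _ =>
      mul_nonneg (hw0 k) (sub_nonneg.2 (hgP k))).1 hsum k (Finset.mem_univ k)
    linarith [(mul_eq_zero.1 this).resolve_left hk]
  obtain ⟨k, hk⟩ : ∃ k, w k ≠ 0 := by
    by_contra! hc
    simp [hc] at hw1
  obtain ⟨l, rfl⟩ : ∃ l, k = l + 1 := ⟨k - 1, by simp⟩
  have n₁ : l ≠ l + 1 := by simpa using fin_one_ne_zero hn
  have n₂ : l ≠ l + 1 + 1 := by rw [add_assoc]; simpa using fin_one_add_one_ne_zero hn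
  have n₃ : l + 1 ≠ l + 1 + 1 := by simpa using fin_one_ne_zero hn
  have hk' := hmax _ hk
  set u := P (l + 1 + 1) - P (l + 1) with hu
  set v := P l - P (l + 1) with hv
  have huv : 0 < cross u v := h (l + 1) l n₁ n₂
  have gu : g u ≤ 0 := by rw [hu, map_sub, hk']; linarith [hgP (l + 1 + 1)]
  have gv : g v ≤ 0 := by rw [hv, map_sub, hk']; linarith [hgP l]
  have hnot : ¬ (g u = 0 ∧ g v = 0) := fun hc =>
    hg0 (eq_zero_of_apply_eq_zero g huv.ne' hc.1 hc.2)
  -- Every other vertex lies strictly inside the cone spanned by `u` and `v`. If `g` vanished on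
  -- `z`, the relation `e`, with positive coefficients, would force `g u = g v = 0`.
  have hfar : ∀ j, j ≠ l → j ≠ l + 1 → j ≠ l + 1 + 1 → w j = 0 := by
    intro j j₁ j₂ j₃
    by_contra hj
    have gj := hmax j hj
    set z := P j - P (l + 1) with hz
    have gz : g z = 0 := by rw [hz, map_sub, hk', gj, sub_self]
    have A : 0 < cross u z := h (l + 1) j j₂ j₃
    have B : 0 < cross z v := by
      have := h l j j₁ j₂
      have e : cross z v = cross (P (l + 1) - P l) (P j - P l) := by
        simp [cross, hz, hv]; ring
      rwa [e]
    have e : cross u v • z = cross z v • u + cross u z • v := by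
      apply ext_coord <;> simp [cross] <;> ring
    have := congrArg g e
    simp only [map_smul, map_add, smul_eq_mul, gz, mul_zero] at this
    apply hnot
    constructor <;> nlinarith [mul_nonneg B.le (neg_nonneg.2 gu), mul_nonneg A.le (neg_nonneg.2 gv)]
  rw [boundary, Set.mem_iUnion]
  by_cases h₀ : w l = 0
  · refine ⟨l + 1, ?_⟩
    rw [← hwx]
    refine mem_edgeSet_of_weights hw0 hw1 n₃ fun j j₁ j₂ => ?_
    by_cases hj : j = l
    · rw [hj, h₀]
    · exact hfar j hj j₁ j₂
  · refine ⟨l, ?_⟩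
    rw [← hwx]
    refine mem_edgeSet_of_weights hw0 hw1 n₁ fun j j₁ j₂ => ?_
    by_cases hj : j = l + 1 + 1
    · by_contra hj0
      refine hnot ⟨?_, ?_⟩
      · rw [hu, map_sub, hk', ← hj, hmax j hj0, sub_self]
      · rw [hv, map_sub, hk', hmax l h₀, sub_self]
    · exact hfar j j₁ j₂ hj

theorem isConvex (h : P.IsStrictlyLeft) (hn : 3 ≤ n) : P.IsConvex where
  simple :=
    { injective := h.injective hn
      adjacent := h.adjacent hn
      nonadjacent := fun i j h₁ h₂ h₃ => h.nonadjacent i j h₁ h₂ h₃ }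
  boundary_eq := Set.Subset.antisymm
    (Set.iUnion_subset fun i => h.edgeSet_subset_frontier hn i) (h.frontier_subset_boundary hn)

theorem angle_ne (h : P.IsStrictlyLeft) (hn : 3 ≤ n) (i : Fin n) :
    ∠ (P i) (P (i + 1)) (P (i + 2)) ≠ 0 ∧ ∠ (P i) (P (i + 1)) (P (i + 2)) ≠ Real.pi := by
  have e2 : i + 2 = i + 1 + 1 := by rw [add_assoc, fin_two_eq]
  refine angle_ne_of_cross_ne_zero ?_
  rw [e2]
  have := h (i + 1) i (by simpa using fin_one_ne_zero hn)
    (by rw [add_assoc]; simpa using fin_one_add_one_ne_zero hn)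
  have e : cross (P i -ᵥ P (i + 1)) (P (i + 1 + 1) -ᵥ P (i + 1))
      = - cross (P (i + 1 + 1) - P (i + 1)) (P i - P (i + 1)) := by
    simp [cross]; ring
  rw [e]
  exact (neg_neg_of_pos this).ne

end IsStrictlyLeft

/-! ### Perpendicularity through inner products -/

/-- The perpendicularity property, in terms of inner products. -/
theorem hasPerpendicularSides_of_inner {P : Polygon Plane n} (hne : ∀ i, P (i + 1) - P i ≠ 0)
    (h : ∀ i, ⟪P i - P 0, P (i + 1) - P i⟫ = 0 ∨ ⟪P (i + 1) - P 0, P (i + 1) - P i⟫ = 0) :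
    P.HasPerpendicularSides := by
  intro i
  have : Fact (Module.finrank ℝ Plane = 1 + 1) := ⟨by simp⟩
  refine ⟨AffineSubspace.mk' (P 0) (Submodule.span ℝ {P (i + 1) - P i})ᗮ, ?_, ?_,
    AffineSubspace.self_mem_mk' _ _, ?_⟩
  · rw [AffineSubspace.direction_mk']
    exact Submodule.finrank_orthogonal_span_singleton (hne i)
  · rw [AffineSubspace.direction_mk', direction_affineSpan, vectorSpan_pair]
    rw [Submodule.isOrtho_comm, Submodule.isOrtho_iff_le, Submodule.orthogonal_orthogonal]
    rw [Submodule.span_singleton_le_iff_mem, Submodule.mem_span_singleton]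
    exact ⟨-1, by simp⟩
  · simp only [AffineSubspace.mem_mk', Submodule.mem_orthogonal_singleton_iff_inner_left]
    exact h i

/-- The perpendicularity property, in terms of inner products. -/
theorem HasPerpendicularSides.inner {P : Polygon Plane n} (h : P.HasPerpendicularSides)
    (i : Fin n) :
    ⟪P i - P 0, P (i + 1) - P i⟫ = 0 ∨ ⟪P (i + 1) - P 0, P (i + 1) - P i⟫ = 0 := by
  obtain ⟨l, -, hl, h0, hi⟩ := h i
  have hd : P (i + 1) - P i ∈ (line[ℝ, P i, P (i + 1)]).direction :=
    AffineSubspace.vsub_mem_direction (right_mem_affineSpan_pair ℝ _ _)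
      (left_mem_affineSpan_pair ℝ _ _)
  exact hi.imp
    (fun hi => Submodule.isOrtho_iff_inner_eq.1 hl _ (AffineSubspace.vsub_mem_direction hi h0) _ hd)
    (fun hi => Submodule.isOrtho_iff_inner_eq.1 hl _ (AffineSubspace.vsub_mem_direction hi h0) _ hd)

end Polygon

/-! ### The two explicit polygons -/

theorem Plane.dist_eq_of_sq {u v : Plane} {c : ℝ} (hc : 0 ≤ c)
    (h : (u 0 - v 0) ^ 2 + (u 1 - v 1) ^ 2 = c ^ 2) : dist u v = c := by
  rw [EuclideanSpace.dist_eq, Fin.sum_univ_two, Real.dist_eq, Real.dist_eq, sq_abs, sq_abs, h,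
    Real.sqrt_sq hc]

theorem Plane.dist_sq (u v : Plane) : dist u v ^ 2 = (u 0 - v 0) ^ 2 + (u 1 - v 1) ^ 2 := by
  rw [dist_eq_norm, norm_sq_eq]; simp

namespace Polygon

/-- The `3`-`4`-`5` triangle. -/
noncomputable def triangle345 : Polygon Plane 3 :=
  ⟨![!₂[0, 0], !₂[3, 0], !₂[3, 4]]⟩

/-- The convex pentagon with sides `10, 11, 12, 13, 14`. -/
noncomputable def pentagon : Polygon Plane 5 :=
  -- The third vertex has norm `√221`, as `10² + 11² = 221`; adding `12 / √221` times its quarter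
  -- turn gives the fourth. The last is the fourth turned by `arctan (13 / 14)` and shortened to
  -- length `14`, whence `365 = 13² + 14²`.
  ⟨![!₂[0, 0], !₂[10, 0], !₂[10, 11],
    !₂[10 - 132 * (√221 / 221), 11 + 120 * (√221 / 221)],
    !₂[(-42 - 47712 * (√221 / 221)) / 365, (3976 - 504 * (√221 / 221)) / 365]]⟩

theorem triangle345_isStrictlyLeft : triangle345.IsStrictlyLeft := by
  intro i k
  fin_cases i <;> fin_cases k <;> simp [triangle345, cross]

theorem triangle345_sideLength (i : Fin 3) :
    triangle345.sideLength i = ((2 : ℕ) : ℝ) + 1 + (i : ℕ) := by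
  refine dist_eq_of_sq (by positivity) ?_
  fin_cases i <;> simp [triangle345] <;> norm_num

theorem triangle345_comesFrom : triangle345.ComesFrom 2 4 5 where
  lt_b := by norm_num
  lt_c := by norm_num
  sum_eq := by decide
  sides := by norm_num
  length := triangle345_sideLength
  first_arm i hi := by
    rw [inner_eq]
    fin_cases i <;> simp [triangle345] at hi ⊢
  second_arm i hi := by
    rw [inner_eq]
    fin_cases i <;> simp [triangle345] at hi ⊢

theorem ComesFrom.isArithmetic {n : ℕ} [NeZero n] {P : Polygon Plane n} {a b c : ℕ}
    (h : P.ComesFrom a b c) (hP : P.IsStrictlyLeft) : P.IsArithmetic := by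
  have hn : 3 ≤ n := by
    have h₁ := h.lt_b
    have h₂ := h.lt_c
    have h₃ := h.sides
    omega
  refine ⟨hn, ⟨a, h.length⟩, hasPerpendicularSides_of_inner (hP.edge_ne_zero hn) fun i => ?_,
    hP.angle_ne hn⟩
  exact (le_or_gt (a + 1 + (i : ℕ)) b).imp (h.first_arm i) (h.second_arm i)

theorem sqrt_bounds : 0.0672 < √221 / 221 ∧ √221 / 221 < 0.0673 ∧
    (√221 / 221) ^ 2 = 1 / 221 := by
  refine ⟨?_, ?_, ?_⟩
  · rw [lt_div_iff₀ (by norm_num), Real.lt_sqrt (by norm_num)]; norm_num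
  · rw [div_lt_iff₀ (by norm_num), Real.sqrt_lt' (by norm_num)]; norm_num
  · rw [div_pow, Real.sq_sqrt (by norm_num)]; norm_num

theorem pentagon_isStrictlyLeft : pentagon.IsStrictlyLeft := by
  obtain ⟨h₁, h₂, h₃⟩ := sqrt_bounds
  intro i k
  fin_cases i <;> fin_cases k <;> simp [pentagon, cross] <;>
    generalize √221 / 221 = s at * <;> nlinarith

theorem pentagon_sideLength (i : Fin 5) :
    pentagon.sideLength i = ((9 : ℕ) : ℝ) + 1 + (i : ℕ) := by
  obtain ⟨h₁, h₂, h₃⟩ := sqrt_bounds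
  refine dist_eq_of_sq (by positivity) ?_
  fin_cases i <;> simp [pentagon] <;>
    generalize √221 / 221 = s at * <;> ring_nf <;> (try rw [h₃]) <;> (try norm_num)

theorem pentagon_comesFrom : pentagon.ComesFrom 9 12 14 where
  lt_b := by norm_num
  lt_c := by norm_num
  sum_eq := by decide
  sides := by norm_num
  length := pentagon_sideLength
  first_arm i hi := by
    rw [inner_eq]
    fin_cases i <;> simp [pentagon] at hi ⊢
    ring
  second_arm i hi := by
    rw [inner_eq]
    fin_cases i <;> simp [pentagon] at hi ⊢
    ring

/-- The triangle fits in a disc of radius `5`, so no two of its points are `14` apart, unlike two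
vertices of the pentagon. -/
theorem not_triangle345_rigidEquiv_pentagon : ¬ triangle345.RigidEquiv pentagon := by
  rintro ⟨e, he⟩
  have hQ : ∀ i, pentagon i ∈ pentagon.boundary ℝ := fun i =>
    Set.mem_iUnion.2 ⟨i, by rw [edgeSet_eq_segment]; exact left_mem_segment _ _ _⟩
  have hT : triangle345.boundary ℝ ⊆ Metric.closedBall 0 5 := by
    refine Set.iUnion_subset fun i => (edgeSet_subset_convexHull _ i).trans ?_
    refine convexHull_min ?_ (convex_closedBall _ _)
    rintro _ ⟨j, rfl⟩
    rw [mem_closedBall_zero_iff]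
    refine (sq_le_sq₀ (norm_nonneg _) (by norm_num)).1 ?_
    rw [norm_sq_eq]
    fin_cases j <;> simp [triangle345] <;> norm_num
  have h₁ := hQ (4 : Fin 5)
  have h₂ := hQ ((4 : Fin 5) + 1)
  rw [← he] at h₁ h₂
  obtain ⟨x, hx, hx'⟩ := h₁
  obtain ⟨y, hy, hy'⟩ := h₂
  have hd : dist x y = 14 := by
    rw [← e.dist_eq, hx', hy']
    exact (pentagon_sideLength 4).trans (by norm_num)
  have h₃ := dist_triangle_right x y 0
  have h₄ := Metric.mem_closedBall.1 (hT hx)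
  have h₅ := Metric.mem_closedBall.1 (hT hy)
  linarith

/-! ### Isometries and adapted frames -/

/-- Matching vertices suffices because an isometry of the plane is affine (Mazur–Ulam) and so
carries sides to sides. -/
theorem rigidEquiv_of_isometryEquiv {n : ℕ} [NeZero n] {P Q : Polygon Plane n}
    (e : Plane ≃ᵢ Plane) (h : ∀ i, e (P i) = Q i) : P.RigidEquiv Q := by
  refine ⟨e, ?_⟩
  rw [boundary, boundary, Set.image_iUnion]
  refine Set.iUnion_congr fun i => ?_
  rw [edgeSet, edgeSet, ← h, ← h]
  have := affineSegment_image (R := ℝ)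
    e.toRealAffineIsometryEquiv.toAffineEquiv.toAffineMap (P i) (P (finRotate n i))
  simpa using this

/-- The isometry to the coordinate system with origin `O` and unit vector `u` on the first axis,
of either orientation. -/
noncomputable def _root_.Plane.frameIsometry (O u : Plane) (ε : ℝ) (hu : ‖u‖ = 1)
    (hε : ε ^ 2 = 1) : Plane ≃ᵢ Plane where
  toFun p := !₂[⟪u, p - O⟫, ε * cross u (p - O)]
  invFun p := O + !₂[p 0 * u 0 - ε * p 1 * u 1, p 0 * u 1 + ε * p 1 * u 0]
  left_inv p := by
    have h : u 0 ^ 2 + u 1 ^ 2 = 1 := by rw [← norm_sq_eq, hu, one_pow]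
    apply ext_coord <;> simp [inner_eq, cross]
    · linear_combination (p 0 - O 0) * h - u 1 * (u 0 * (p 1 - O 1) - u 1 * (p 0 - O 0)) * hε
    · linear_combination (p 1 - O 1) * h + u 0 * (u 0 * (p 1 - O 1) - u 1 * (p 0 - O 0)) * hε
  right_inv p := by
    have h : u 0 ^ 2 + u 1 ^ 2 = 1 := by rw [← norm_sq_eq, hu, one_pow]
    apply ext_coord <;> simp [inner_eq, cross]
    · linear_combination p 0 * h
    · linear_combination p 1 * h + p 1 * (u 0 ^ 2 + u 1 ^ 2) * hε
  isometry_toFun := by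
    have h : u 0 ^ 2 + u 1 ^ 2 = 1 := by rw [← norm_sq_eq, hu, one_pow]
    refine Isometry.of_dist_eq fun p q => ?_
    refine (sq_eq_sq₀ dist_nonneg dist_nonneg).1 ?_
    rw [dist_sq, dist_sq]
    simp only [inner_eq, cross, PiLp.sub_apply, Matrix.cons_val_zero,
      Matrix.cons_val_one]
    linear_combination ((p 0 - q 0) ^ 2 + (p 1 - q 1) ^ 2) * h
      + (u 0 * (p 1 - q 1) - u 1 * (p 0 - q 0)) ^ 2 * hε

end Polygon

/-! ### Rotating vectors -/

/-- A plane vector is turned successively by the angles `arctan (t j)` and rescaled. If it starts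
on the positive first axis and never leaves the upper half-plane, then the total angle is at most
`π`. -/
theorem sum_arctan_le_pi {x y t l : ℕ → ℝ} {N : ℕ} (hx : 0 < x 0) (hy : y 0 = 0)
    (ht : ∀ j < N, 0 ≤ t j) (hl : ∀ j < N, 0 < l j)
    (hxs : ∀ j < N, l j * x (j + 1) = x j - t j * y j)
    (hys : ∀ j < N, l j * y (j + 1) = y j + t j * x j) (hpos : ∀ j ≤ N, 0 ≤ y j) :
    ∑ j ∈ Finset.range N, Real.arctan (t j) ≤ Real.pi := by
  -- The polar angle of the vector is tracked as a real number, not modulo `2π`; the bound by `π`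
  -- belongs to the induction.
  suffices h : ∀ M ≤ N, (∑ j ∈ Finset.range M, Real.arctan (t j) ≤ Real.pi) ∧
      0 ≤ ∑ j ∈ Finset.range M, Real.arctan (t j) ∧
      ∃ ρ > 0, x M = ρ * Real.cos (∑ j ∈ Finset.range M, Real.arctan (t j)) ∧
        y M = ρ * Real.sin (∑ j ∈ Finset.range M, Real.arctan (t j)) from (h N le_rfl).1
  intro M
  induction M with
  | zero => exact fun _ => ⟨by simpa using Real.pi_pos.le, by simp, x 0, hx, by simp, by simp [hy]⟩
  | succ M ih =>
    intro hM
    obtain ⟨h₁, h₂, ρ, hρ, hxM, hyM⟩ := ih (by omega)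
    rw [Finset.sum_range_succ]
    set A := ∑ j ∈ Finset.range M, Real.arctan (t j)
    have hα₀ : 0 ≤ Real.arctan (t M) := Real.arctan_nonneg.2 (ht M hM)
    have hα₁ := Real.arctan_lt_pi_div_two (t M)
    have hs : 0 < √(1 + t M ^ 2) := Real.sqrt_pos.2 (by positivity)
    have hlM := hl M hM
    have hcos : √(1 + t M ^ 2) * Real.cos (Real.arctan (t M)) = 1 := by
      rw [Real.cos_arctan]; field_simp
    have hsin : √(1 + t M ^ 2) * Real.sin (Real.arctan (t M)) = t M := by
      rw [Real.sin_arctan]; field_simp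
    have hρ' : 0 < ρ * √(1 + t M ^ 2) / l M := by positivity
    have hX : x (M + 1) = ρ * √(1 + t M ^ 2) / l M * Real.cos (A + Real.arctan (t M)) := by
      rw [Real.cos_add]
      field_simp
      have := hxs M hM
      rw [hxM, hyM] at this
      linear_combination this - ρ * Real.cos A * hcos + ρ * Real.sin A * hsin
    have hY : y (M + 1) = ρ * √(1 + t M ^ 2) / l M * Real.sin (A + Real.arctan (t M)) := by
      rw [Real.sin_add]
      field_simp
      have := hys M hM
      rw [hxM, hyM] at this
      linear_combination this - ρ * Real.sin A * hcos - ρ * Real.cos A * hsin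
    refine ⟨?_, by linarith, _, hρ', hX, hY⟩
    -- One turn is less than `π / 2`, so an angle that has just passed `π` is still below `2π` and
    -- its sine is negative.
    by_contra! hc
    have hneg : Real.sin (A + Real.arctan (t M)) < 0 := by
      rw [← neg_pos, ← Real.sin_sub_pi]
      exact Real.sin_pos_of_pos_of_lt_pi (by linarith) (by linarith)
    have := hpos (M + 1) hM
    rw [hY] at this
    exact absurd this (not_le.2 (mul_neg_of_pos_of_neg hρ' hneg))

namespace Plane

/-- The vector `e` is `p` turned by a right angle in the direction of `ε` and scaled by `‖e‖ / ‖p‖`;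
a quarter turn interchanges inner product and determinant up to sign. -/
theorem inner_cross_of_perp {ε : ℝ} (hε : ε ^ 2 = 1) {p e : Plane} (hp : p ≠ 0)
    (h : ⟪p, e⟫ = 0) (hc : 0 ≤ ε * cross p e) (w : Plane) :
    ⟪w, e⟫ = -(‖e‖ / ‖p‖ * (ε * cross w p)) ∧ ε * cross w e = ‖e‖ / ‖p‖ * ⟪w, p⟫ := by
  have hn : 0 < ‖p‖ := norm_pos_iff.2 hp
  have hcr : ε * cross p e = ‖p‖ * ‖e‖ := by
    refine (sq_eq_sq₀ hc (by positivity)).1 ?_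
    have := cross_sq_add_inner_sq p e
    rw [h] at this
    linear_combination this + cross p e ^ 2 * hε
  have hns := norm_sq_eq p
  have h₀ : ‖p‖ ^ 2 * e 0 = -(ε * (‖p‖ * ‖e‖)) * p 1 := by
    rw [hns, ← hcr]
    rw [inner_eq] at h
    simp only [cross]
    linear_combination p 0 * h + p 1 * (p 0 * e 1 - p 1 * e 0) * hε
  have h₁ : ‖p‖ ^ 2 * e 1 = ε * (‖p‖ * ‖e‖) * p 0 := by
    rw [hns, ← hcr]
    rw [inner_eq] at h
    simp only [cross]
    linear_combination p 1 * h - p 0 * (p 0 * e 1 - p 1 * e 0) * hε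
  have h₀' : e 0 = -(ε * (‖e‖ / ‖p‖)) * p 1 := by
    field_simp
    refine mul_left_cancel₀ hn.ne' ?_
    linear_combination h₀
  have h₁' : e 1 = ε * (‖e‖ / ‖p‖) * p 0 := by
    field_simp
    refine mul_left_cancel₀ hn.ne' ?_
    linear_combination h₁
  rw [inner_eq, inner_eq, cross, cross, h₀', h₁']
  constructor
  · ring
  · linear_combination (‖e‖ / ‖p‖) * (w 0 * p 0 + w 1 * p 1) * hε

end Plane

/-! ### Sequences of vertices, seen from the special vertex -/

/-- The vertices `q 0 = 0, q 1, …, q n = 0` of an arithmetic polygon, taken relative to the special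
vertex, when the polygon lies to the left (`ε = 1`) or to the right (`ε = -1`) of its sides. -/
structure IsConvexChain (q : ℕ → Plane) (n a : ℕ) (ε : ℝ) : Prop where
  three_le : 3 ≤ n
  sign : ε ^ 2 = 1
  first : q 0 = 0
  last : q n = 0
  ne_zero : ∀ j, 1 ≤ j → j < n → q j ≠ 0
  norm_side : ∀ j < n, ‖q (j + 1) - q j‖ = (a : ℝ) + 1 + j
  perp : ∀ j < n, ⟪q j, q (j + 1) - q j⟫ = 0 ∨ ⟪q (j + 1), q (j + 1) - q j⟫ = 0
  turn : ∀ j, cross (q (j + 1) - q j) (q (j + 2) - q (j + 1)) ≠ 0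
  cross_side : ∀ j, 0 ≤ ε * cross (q j) (q (j + 1))
  cross_first : ∀ j, 0 ≤ ε * cross (q 1) (q j)

namespace IsConvexChain

variable {q : ℕ → Plane} {n a : ℕ} {ε : ℝ}

/-- The apex is the start of the first side perpendicular to its second diagonal. One exists because
the last side ends at `O`. From there on the alternative is excluded inductively: it would make two
consecutive sides parallel. -/
theorem exists_apex (h : IsConvexChain q n a ε) : ∃ m, 1 ≤ m ∧ m < n ∧
    (∀ j < m, ⟪q j, q (j + 1) - q j⟫ = 0) ∧
    ∀ j, m ≤ j → j < n → ⟪q (j + 1), q (j + 1) - q j⟫ = 0 := by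
  classical
  have hn := h.three_le
  have hex : ∃ j, ⟪q (j + 1), q (j + 1) - q j⟫ = 0 :=
    ⟨n - 1, by rw [Nat.sub_add_cancel (by omega), h.last, inner_zero_left]⟩
  have hle : Nat.find hex ≤ n - 1 := Nat.find_min' hex
    (by rw [Nat.sub_add_cancel (by omega), h.last, inner_zero_left])
  refine ⟨Nat.find hex, ?_, by omega, fun j hj => ?_, fun j hj hjn => ?_⟩
  · by_contra hlt
    have h0 : Nat.find hex = 0 := by omega
    have := Nat.find_spec hex
    rw [h0, h.first, sub_zero, zero_add, inner_self_eq_zero] at this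
    exact h.ne_zero 1 le_rfl (by omega) this
  · exact (h.perp j (by omega)).resolve_right (Nat.find_min hex hj)
  · induction j, hj using Nat.le_induction with
    | base => exact Nat.find_spec hex
    | succ j hj ih =>
      refine (h.perp (j + 1) hjn).resolve_left fun h' => h.turn j ?_
      exact cross_eq_zero_of_inner_eq_zero (h.ne_zero (j + 1) (by omega) hjn) (ih (by omega)) h'

theorem first_step (h : IsConvexChain q n a ε) {j : ℕ} (hj : 1 ≤ j) (hjn : j < n)
    (hp : ⟪q j, q (j + 1) - q j⟫ = 0) :
    ⟪q 1, q (j + 1)⟫ = ⟪q 1, q j⟫ - ((a : ℝ) + 1 + j) / ‖q j‖ * (ε * cross (q 1) (q j)) ∧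
    ε * cross (q 1) (q (j + 1))
      = ε * cross (q 1) (q j) + ((a : ℝ) + 1 + j) / ‖q j‖ * ⟪q 1, q j⟫ := by
  have hc : 0 ≤ ε * cross (q j) (q (j + 1) - q j) := by
    rw [cross_sub_right, cross_self, sub_zero]; exact h.cross_side j
  have := inner_cross_of_perp h.sign (h.ne_zero j hj hjn) hp hc (q 1)
  rw [h.norm_side j hjn, inner_sub_right, cross_sub_right] at this
  constructor <;> linarith [this.1, this.2]

/-- The right angle is now at the new vertex, so the perpendicularity relation expresses the old
vertex through the new one. Inverting this linear system produces the factor `1 + t ^ 2`. -/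
theorem second_step (h : IsConvexChain q n a ε) {j : ℕ} (hjn : j + 1 < n)
    (hp : ⟪q (j + 1), q (j + 1) - q j⟫ = 0) :
    (1 + (((a : ℝ) + 1 + j) / ‖q (j + 1)‖) ^ 2) * ⟪q 1, q (j + 1)⟫
      = ⟪q 1, q j⟫ - ((a : ℝ) + 1 + j) / ‖q (j + 1)‖ * (ε * cross (q 1) (q j)) ∧
    (1 + (((a : ℝ) + 1 + j) / ‖q (j + 1)‖) ^ 2) * (ε * cross (q 1) (q (j + 1)))
      = ε * cross (q 1) (q j) + ((a : ℝ) + 1 + j) / ‖q (j + 1)‖ * ⟪q 1, q j⟫ := by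
  have hc : 0 ≤ ε * cross (q (j + 1)) (q (j + 1) - q j) := by
    have e : cross (q (j + 1)) (q (j + 1) - q j) = cross (q j) (q (j + 1)) := by
      simp [cross]; ring
    rw [e]; exact h.cross_side j
  have := inner_cross_of_perp h.sign (h.ne_zero (j + 1) (by omega) hjn) hp hc (q 1)
  rw [h.norm_side j (by omega), inner_sub_right, cross_sub_right] at this
  obtain ⟨h₁, h₂⟩ := this
  generalize ((a : ℝ) + 1 + j) / ‖q (j + 1)‖ = t at *
  constructor
  · linear_combination h₁ - t * h₂
  · linear_combination h₂ + t * h₁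

theorem norm_sq_first (h : IsConvexChain q n a ε) {m : ℕ} (hmn : m ≤ n)
    (hf : ∀ j < m, ⟪q j, q (j + 1) - q j⟫ = 0) (j : ℕ) (hj : j ≤ m) :
    ‖q j‖ ^ 2 = ∑ i ∈ Finset.range j, ((a : ℝ) + 1 + i) ^ 2 := by
  induction j with
  | zero => simp [h.first]
  | succ j ih =>
    rw [Finset.sum_range_succ, ← ih (by omega), ← h.norm_side j (by omega)]
    have := norm_add_sq_real (q j) (q (j + 1) - q j)
    rw [hf j hj, add_sub_cancel] at this
    linarith

theorem norm_sq_second (h : IsConvexChain q n a ε) {m : ℕ}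
    (hs : ∀ j, m ≤ j → j < n → ⟪q (j + 1), q (j + 1) - q j⟫ = 0) (j : ℕ) (hjn : j ≤ n)
    (hj : m ≤ j) : ‖q j‖ ^ 2 = ∑ i ∈ Finset.Ico j n, ((a : ℝ) + 1 + i) ^ 2 := by
  induction hjn using Nat.decreasingInduction with
  | self => simp [h.last]
  | of_succ j hjn ih =>
    rw [Finset.sum_eq_sum_Ico_succ_bot hjn, ← ih (by omega), ← h.norm_side j hjn]
    have := norm_sub_sq_real (q (j + 1)) (q (j + 1) - q j)
    rw [hs j hj hjn, sub_sub_cancel] at this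
    linarith

theorem sum_sq_eq (h : IsConvexChain q n a ε) {m : ℕ} (hmn : m ≤ n)
    (hf : ∀ j < m, ⟪q j, q (j + 1) - q j⟫ = 0)
    (hs : ∀ j, m ≤ j → j < n → ⟪q (j + 1), q (j + 1) - q j⟫ = 0) :
    ∑ i ∈ Finset.range m, (a + 1 + i) ^ 2 = ∑ i ∈ Finset.Ico m n, (a + 1 + i) ^ 2 := by
  have := (h.norm_sq_first hmn hf m le_rfl).symm.trans (h.norm_sq_second hs m hmn le_rfl)
  exact_mod_cast this

/-- The tangents of the angles at which the sides, other than the two at the special vertex, are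
seen from that vertex. -/
noncomputable def tangent (q : ℕ → Plane) (a m : ℕ) (k : ℕ) : ℝ :=
  if k + 1 < m then ((a : ℝ) + 1 + (k + 1 : ℕ)) / ‖q (k + 1)‖
  else ((a : ℝ) + 1 + (k + 1 : ℕ)) / ‖q (k + 2)‖

theorem tangent_nonneg (q : ℕ → Plane) (a m k : ℕ) : 0 ≤ tangent q a m k := by
  unfold tangent
  split_ifs <;> positivity

/-- Relative to the direction of `q 1`, passing to the next vertex is a rotation by `arctan` of the
tangent with a positive rescaling; `cross_first` keeps all vertices in one closed half-plane. -/
theorem sum_arctan_tangent_le (h : IsConvexChain q n a ε) {m : ℕ}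
    (hf : ∀ j < m, ⟪q j, q (j + 1) - q j⟫ = 0)
    (hs : ∀ j, m ≤ j → j < n → ⟪q (j + 1), q (j + 1) - q j⟫ = 0) :
    ∑ k ∈ Finset.range (n - 2), Real.arctan (tangent q a m k) ≤ Real.pi := by
  have hn := h.three_le
  refine sum_arctan_le_pi (x := fun k => ⟪q 1, q (k + 1)⟫)
    (y := fun k => ε * cross (q 1) (q (k + 1)))
    (l := fun k => if k + 1 < m then 1 else 1 + tangent q a m k ^ 2) ?_ ?_
    (fun j _ => tangent_nonneg q a m j) (fun j _ => ?_) (fun j hj => ?_) (fun j hj => ?_)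
    (fun j _ => h.cross_first _)
  · exact real_inner_self_pos.2 (h.ne_zero 1 le_rfl (by omega))
  · simp [cross_self]
  · split_ifs <;> positivity
  · unfold tangent
    split_ifs with hm
    · rw [one_mul]
      exact (h.first_step (by omega) (by omega) (hf _ hm)).1
    · exact (h.second_step (by omega) (hs (j + 1) (by omega) (by omega))).1
  · unfold tangent
    split_ifs with hm
    · rw [one_mul]
      exact (h.first_step (by omega) (by omega) (hf _ hm)).2
    · exact (h.second_step (by omega) (hs (j + 1) (by omega) (by omega))).2

theorem le_tangent_first (h : IsConvexChain q n a ε) {m k : ℕ} (hmn : m ≤ n)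
    (hf : ∀ j < m, ⟪q j, q (j + 1) - q j⟫ = 0) (hk : k + 1 < m) {c : ℝ} (hc : 0 ≤ c)
    (hle : c ^ 2 * ∑ i ∈ Finset.range (k + 1), ((a : ℝ) + 1 + i) ^ 2
      ≤ ((a : ℝ) + 1 + (k + 1 : ℕ)) ^ 2) : c ≤ tangent q a m k := by
  rw [tangent, if_pos hk, le_div_iff₀ (norm_pos_iff.2 (h.ne_zero _ (by omega) (by omega)))]
  refine (sq_le_sq₀ (by positivity) (by positivity)).1 ?_
  rwa [mul_pow, h.norm_sq_first hmn hf _ hk.le]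

theorem le_tangent_second (h : IsConvexChain q n a ε) {m k : ℕ}
    (hs : ∀ j, m ≤ j → j < n → ⟪q (j + 1), q (j + 1) - q j⟫ = 0) (hk : m ≤ k + 1)
    (hkn : k + 2 < n) {c : ℝ} (hc : 0 ≤ c)
    (hle : c ^ 2 * ∑ i ∈ Finset.Ico (k + 2) n, ((a : ℝ) + 1 + i) ^ 2
      ≤ ((a : ℝ) + 1 + (k + 1 : ℕ)) ^ 2) : c ≤ tangent q a m k := by
  rw [tangent, if_neg (by omega),
    le_div_iff₀ (norm_pos_iff.2 (h.ne_zero _ (by omega) (by omega)))]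
  refine (sq_le_sq₀ (by positivity) (by positivity)).1 ?_
  rwa [mul_pow, h.norm_sq_second hs _ hkn.le (by omega)]

end IsConvexChain

/-! ### Numerical bounds for sums of arctangents -/

/-- As `x * y > 1`, the sum is `π` plus the arctangent of a quotient that the last hypothesis places
above `-1`. A further `arctan 1` then brings the total above `π`. -/
theorem pi_lt_arctan_add_arctan {x y : ℝ} (hx : 0 < x) (hxy : 1 < x * y) (h : x + y < x * y - 1) :
    3 * (Real.pi / 4) < Real.arctan x + Real.arctan y := by
  rw [Real.arctan_add_eq_add_pi hxy hx]
  have : Real.arctan (-1) < Real.arctan ((x + y) / (1 - x * y)) := by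
    refine Real.arctan_strictMono ?_
    rw [lt_div_iff_of_neg (by linarith)]
    linarith
  rw [Real.arctan_neg, Real.arctan_one] at this
  linarith

theorem arctan_add_arctan_eq {x y z : ℝ} (h : x * y < 1) (hz : z * (1 - x * y) = x + y) :
    Real.arctan x + Real.arctan y = Real.arctan z := by
  rw [Real.arctan_add h, ← hz, mul_div_cancel_right₀ _ (by linarith)]

theorem pi_lt_sum_arctan_six : Real.pi < Real.arctan 1 + Real.arctan 0.7 + Real.arctan 0.57 +
    Real.arctan 0.5 + Real.arctan 0.44 + Real.arctan 0.4 := by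
  have h₁ : Real.arctan 0.7 + Real.arctan 0.57 = Real.arctan (1270 / 601) :=
    arctan_add_arctan_eq (by norm_num) (by norm_num)
  have h₂ : Real.arctan 0.5 + Real.arctan 0.44 = Real.arctan (47 / 39) :=
    arctan_add_arctan_eq (by norm_num) (by norm_num)
  have h₃ : Real.arctan (47 / 39) + Real.arctan 0.4 = Real.arctan (313 / 101) :=
    arctan_add_arctan_eq (by norm_num) (by norm_num)
  have h₄ := pi_lt_arctan_add_arctan (x := 1270 / 601) (y := 313 / 101) (by norm_num)
    (by norm_num) (by norm_num)
  rw [Real.arctan_one]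
  linarith

theorem pi_lt_sum_arctan_five : Real.pi < Real.arctan 1 + Real.arctan 0.7 + Real.arctan 0.57 +
    Real.arctan 0.5 + Real.arctan 0.97 := by
  have h₁ : Real.arctan 0.7 + Real.arctan 0.57 = Real.arctan (1270 / 601) :=
    arctan_add_arctan_eq (by norm_num) (by norm_num)
  have h₂ : Real.arctan 0.5 + Real.arctan 0.97 = Real.arctan (294 / 103) :=
    arctan_add_arctan_eq (by norm_num) (by norm_num)
  have h₄ := pi_lt_arctan_add_arctan (x := 1270 / 601) (y := 294 / 103) (by norm_num)
    (by norm_num) (by norm_num)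
  rw [Real.arctan_one]
  linarith

theorem pi_lt_sum_arctan_five' : Real.pi < Real.arctan 1 + Real.arctan 0.7 + Real.arctan 0.57 +
    Real.arctan 0.66 + Real.arctan 0.96 := by
  have h₁ : Real.arctan 0.7 + Real.arctan 0.57 = Real.arctan (1270 / 601) :=
    arctan_add_arctan_eq (by norm_num) (by norm_num)
  have h₂ : Real.arctan 0.66 + Real.arctan 0.96 = Real.arctan (2025 / 458) :=
    arctan_add_arctan_eq (by norm_num) (by norm_num)
  have h₄ := pi_lt_arctan_add_arctan (x := 1270 / 601) (y := 2025 / 458) (by norm_num)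
    (by norm_num) (by norm_num)
  rw [Real.arctan_one]
  linarith

/-! ### Two adjacent blocks of consecutive squares with equal sums -/

/-- The second block has the larger terms, so it must be shorter. -/
theorem sub_lt_of_sum_sq_eq {a m n : ℕ} (hm : 1 ≤ m)
    (h : ∑ i ∈ Finset.range m, (a + 1 + i) ^ 2 = ∑ i ∈ Finset.Ico m n, (a + 1 + i) ^ 2) :
    n - m < m := by
  by_contra! hc
  rw [Finset.sum_Ico_eq_sum_range] at h
  have h₁ : ∑ i ∈ Finset.range m, (a + 1 + i) ^ 2
      < ∑ i ∈ Finset.range m, (a + 1 + (m + i)) ^ 2 := by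
    refine Finset.sum_lt_sum_of_nonempty ⟨0, Finset.mem_range.2 hm⟩ fun i _ => ?_
    gcongr
    omega
  have h₂ : ∑ i ∈ Finset.range m, (a + 1 + (m + i)) ^ 2
      ≤ ∑ i ∈ Finset.range (n - m), (a + 1 + (m + i)) ^ 2 :=
    Finset.sum_le_sum_of_subset (by simpa using hc)
  omega

theorem eq_of_sum_sq_eq {a m n : ℕ} (hm : 1 ≤ m) (hm' : m ≤ 6) (hn : m < n)
    (h : ∑ i ∈ Finset.range m, (a + 1 + i) ^ 2 = ∑ i ∈ Finset.Ico m n, (a + 1 + i) ^ 2) :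
    (m = 2 ∧ n = 3 ∧ a = 2) ∨ (m = 3 ∧ n = 5 ∧ a = 9) ∨ (m = 4 ∧ n = 7 ∧ a = 20) ∨
    (m = 5 ∧ n = 9 ∧ a = 35) ∨ (m = 6 ∧ n = 11 ∧ a = 54) := by
  have hlt := sub_lt_of_sum_sq_eq hm h
  rw [Finset.sum_Ico_eq_sum_range] at h
  obtain ⟨k, rfl⟩ : ∃ k, n = m + k := ⟨n - m, by omega⟩
  rw [Nat.add_sub_cancel_left] at h hlt
  have hk : 1 ≤ k := by omega
  -- Each pair `(m, k)` leaves a quadratic equation in `a` with leading coefficient `m - k > 0`, so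
  -- `a` is bounded; `60` exceeds the largest solution, `54`.
  interval_cases m <;> interval_cases k <;> simp [Finset.sum_range_succ] at h ⊢ <;>
    (have ha : a ≤ 60 := by by_contra! hc; nlinarith) <;> interval_cases a <;> omega

/-! ### Classification of the convex chains -/

namespace IsConvexChain

variable {q : ℕ → Plane} {n a : ℕ} {ε : ℝ}

/-- The squared diagonal is a sum of `k + 1` squares, each at most the square of the current side,
so the tangent is at least `1 / √(k + 1)` independently of `a`. -/
theorem const_le_tangent (h : IsConvexChain q n a ε) {m k : ℕ} (hmn : m ≤ n)
    (hf : ∀ j < m, ⟪q j, q (j + 1) - q j⟫ = 0) (hk : k + 1 < m) {c : ℝ} (hc : 0 ≤ c)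
    (hck : c ^ 2 * (k + 1) ≤ 1) : c ≤ tangent q a m k := by
  refine h.le_tangent_first hmn hf hk hc ?_
  have : ∑ i ∈ Finset.range (k + 1), ((a : ℝ) + 1 + i) ^ 2
      ≤ (k + 1) * ((a : ℝ) + 1 + (k + 1 : ℕ)) ^ 2 := by
    have := Finset.sum_le_card_nsmul (Finset.range (k + 1)) (fun i : ℕ => ((a : ℝ) + 1 + i) ^ 2)
      (((a : ℝ) + 1 + (k + 1 : ℕ)) ^ 2) fun i hi => by
        have : (i : ℝ) ≤ (k + 1 : ℕ) := Nat.cast_le.2 (Finset.mem_range.1 hi).le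
        gcongr
    simpa using this
  calc c ^ 2 * ∑ i ∈ Finset.range (k + 1), ((a : ℝ) + 1 + i) ^ 2
      ≤ c ^ 2 * ((k + 1) * ((a : ℝ) + 1 + (k + 1 : ℕ)) ^ 2) := by gcongr
    _ = c ^ 2 * (k + 1) * ((a : ℝ) + 1 + (k + 1 : ℕ)) ^ 2 := by ring
    _ ≤ 1 * ((a : ℝ) + 1 + (k + 1 : ℕ)) ^ 2 := by gcongr
    _ = _ := one_mul _

theorem arctan_const_le (h : IsConvexChain q n a ε) {m k : ℕ} (hmn : m ≤ n)
    (hf : ∀ j < m, ⟪q j, q (j + 1) - q j⟫ = 0) (hk : k + 1 < m) {c : ℝ} (hc : 0 ≤ c)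
    (hck : c ^ 2 * (k + 1) ≤ 1) : Real.arctan c ≤ Real.arctan (tangent q a m k) :=
  Real.arctan_mono (h.const_le_tangent hmn hf hk hc hck)

theorem sum_arctan_le (q : ℕ → Plane) (a m : ℕ) {M N : ℕ} (hMN : M ≤ N) :
    ∑ k ∈ Finset.range M, Real.arctan (tangent q a m k)
      ≤ ∑ k ∈ Finset.range N, Real.arctan (tangent q a m k) :=
  Finset.sum_le_sum_of_subset_of_nonneg (by simpa using hMN)
    fun k _ _ => Real.arctan_nonneg.2 (tangent_nonneg q a m k)

theorem apex_le_six (h : IsConvexChain q n a ε) {m : ℕ} (hmn : m < n)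
    (hf : ∀ j < m, ⟪q j, q (j + 1) - q j⟫ = 0)
    (hs : ∀ j, m ≤ j → j < n → ⟪q (j + 1), q (j + 1) - q j⟫ = 0) : m ≤ 6 := by
  by_contra! hm
  have hle := (sum_arctan_le q a m (by omega : 6 ≤ n - 2)).trans (h.sum_arctan_tangent_le hf hs)
  simp only [Finset.sum_range_succ, Finset.sum_range_zero, zero_add] at hle
  -- The constants are `1 / √(k + 1)` rounded down.
  have h₀ := h.arctan_const_le (k := 0) hmn.le hf (by omega) (c := 1) (by norm_num) (by norm_num)
  have h₁ := h.arctan_const_le (k := 1) hmn.le hf (by omega) (c := 0.7) (by norm_num) (by norm_num)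
  have h₂ := h.arctan_const_le (k := 2) hmn.le hf (by omega) (c := 0.57) (by norm_num) (by norm_num)
  have h₃ := h.arctan_const_le (k := 3) hmn.le hf (by omega) (c := 0.5) (by norm_num) (by norm_num)
  have h₄ := h.arctan_const_le (k := 4) hmn.le hf (by omega) (c := 0.44) (by norm_num) (by norm_num)
  have h₅ := h.arctan_const_le (k := 5) hmn.le hf (by omega) (c := 0.4) (by norm_num) (by norm_num)
  linarith [pi_lt_sum_arctan_six]

/-- The angle at the special vertex is too large if there are at least five sides on the first arm
and the last two sides are long. -/
theorem apex_le_four (h : IsConvexChain q n a ε) {m : ℕ} (hmn : m + 2 ≤ n) (hn : 34 ≤ a + n)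
    (hf : ∀ j < m, ⟪q j, q (j + 1) - q j⟫ = 0)
    (hs : ∀ j, m ≤ j → j < n → ⟪q (j + 1), q (j + 1) - q j⟫ = 0) : m ≤ 4 := by
  by_contra! hm
  have hle := h.sum_arctan_tangent_le hf hs
  obtain ⟨N, rfl⟩ : ∃ N, n = N + 3 := ⟨n - 3, by omega⟩
  rw [show N + 3 - 2 = N + 1 by omega, Finset.sum_range_succ] at hle
  have hle' := sum_arctan_le q a m (by omega : 4 ≤ N)
  simp only [Finset.sum_range_succ, Finset.sum_range_zero, zero_add] at hle'
  have h₀ := h.arctan_const_le (k := 0) (by omega) hf (by omega) (c := 1) (by norm_num)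
    (by norm_num)
  have h₁ := h.arctan_const_le (k := 1) (by omega) hf (by omega) (c := 0.7) (by norm_num)
    (by norm_num)
  have h₂ := h.arctan_const_le (k := 2) (by omega) hf (by omega) (c := 0.57) (by norm_num)
    (by norm_num)
  have h₃ := h.arctan_const_le (k := 3) (by omega) hf (by omega) (c := 0.5) (by norm_num)
    (by norm_num)
  -- The last angle used has tangent `(a + n - 1) / (a + n)`, which is at least `33 / 34 > 0.97`.
  have h₄ : Real.arctan 0.97 ≤ Real.arctan (tangent q a m N) := by
    refine Real.arctan_mono (h.le_tangent_second hs (by omega) (by omega) (by norm_num) ?_)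
    have hn' : (34 : ℝ) ≤ a + (N + 3) := by exact_mod_cast hn
    rw [Finset.sum_Ico_succ_top (by omega), Finset.Ico_self, Finset.sum_empty, zero_add, ← mul_pow]
    push_cast
    refine pow_le_pow_left₀ (by positivity) ?_ 2
    linarith
  linarith [pi_lt_sum_arctan_five]

theorem not_four_seven (h : IsConvexChain q 7 20 ε)
    (hf : ∀ j < 4, ⟪q j, q (j + 1) - q j⟫ = 0)
    (hs : ∀ j, 4 ≤ j → j < 7 → ⟪q (j + 1), q (j + 1) - q j⟫ = 0) : False := by
  have hle := h.sum_arctan_tangent_le hf hs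
  simp only [Nat.reduceSub, Finset.sum_range_succ, Finset.sum_range_zero, zero_add] at hle
  have h₀ := h.arctan_const_le (k := 0) (by omega) hf (by omega) (c := 1) (by norm_num)
    (by norm_num)
  have h₁ := h.arctan_const_le (k := 1) (by omega) hf (by omega) (c := 0.7) (by norm_num)
    (by norm_num)
  have h₂ := h.arctan_const_le (k := 2) (by omega) hf (by omega) (c := 0.57) (by norm_num)
    (by norm_num)
  have h₃ : Real.arctan 0.66 ≤ Real.arctan (tangent q 20 4 3) :=
    Real.arctan_mono (h.le_tangent_second hs (by omega) (by omega) (by norm_num)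
      (by norm_num [Finset.sum_Ico_succ_top]))
  have h₄ : Real.arctan 0.96 ≤ Real.arctan (tangent q 20 4 4) :=
    Real.arctan_mono (h.le_tangent_second hs (by omega) (by omega) (by norm_num)
      (by norm_num [Finset.sum_Ico_succ_top]))
  linarith [pi_lt_sum_arctan_five']

theorem classification (h : IsConvexChain q n a ε) :
    ∃ m, (∀ j < m, ⟪q j, q (j + 1) - q j⟫ = 0) ∧
      (∀ j, m ≤ j → j < n → ⟪q (j + 1), q (j + 1) - q j⟫ = 0) ∧
      ((m = 2 ∧ n = 3 ∧ a = 2) ∨ (m = 3 ∧ n = 5 ∧ a = 9)) := by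
  obtain ⟨m, hm, hmn, hf, hs⟩ := h.exists_apex
  refine ⟨m, hf, hs, ?_⟩
  have h₆ := h.apex_le_six hmn hf hs
  rcases eq_of_sum_sq_eq hm h₆ hmn (h.sum_sq_eq hmn.le hf hs) with
    h' | h' | ⟨rfl, rfl, rfl⟩ | ⟨rfl, rfl, rfl⟩ | ⟨rfl, rfl, rfl⟩
  · exact Or.inl h'
  · exact Or.inr h'
  · exact (h.not_four_seven hf hs).elim
  · exact absurd (h.apex_le_four (by norm_num) (by norm_num) hf hs) (by norm_num)
  · exact absurd (h.apex_le_four (by norm_num) (by norm_num) hf hs) (by norm_num)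

end IsConvexChain

/-! ### From convex arithmetic polygons to chains -/

namespace Polygon

variable {n : ℕ} [NeZero n]

theorem fin_ofNat_succ (j : ℕ) : Fin.ofNat n (j + 1) = Fin.ofNat n j + 1 := by
  apply Fin.ext
  simp [Fin.val_add]

/-- Each side of a convex polygon lies on a supporting line. -/
theorem IsConvex.exists_cross_nonneg {P : Polygon Plane n} (h : P.IsConvex) (hn : 3 ≤ n)
    (i : Fin n) : ∃ c : ℝ, c ≠ 0 ∧ ∀ k, 0 ≤ c * cross (P (i + 1) - P i) (P k - P i) := by
  set x : Plane := (1 / 2 : ℝ) • P i + (1 / 2 : ℝ) • P (i + 1) with hx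
  have hxe : x ∈ P.edgeSet ℝ i := by
    rw [edgeSet_eq_segment]
    exact ⟨1 / 2, 1 / 2, by norm_num, by norm_num, by norm_num, rfl⟩
  have hxf : x ∈ frontier (convexHull ℝ (Set.range P.vertices)) := by
    rw [← h.boundary_eq]
    exact Set.mem_iUnion.2 ⟨i, hxe⟩
  obtain ⟨f, hf0, hf⟩ := (convex_convexHull ℝ _).exists_support
    (edgeSet_subset_convexHull P i hxe) hxf.2
  have hfP : ∀ k, f (P k) ≤ f x := fun k => hf _ (subset_convexHull ℝ _ ⟨k, rfl⟩)
  -- A form whose maximum is attained at the midpoint takes equal values at both ends, so it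
  -- vanishes on the direction of the side.
  have hfx : f x = 1 / 2 * f (P i) + 1 / 2 * f (P (i + 1)) := by simp [hx]
  have h₁ := hfP i
  have h₂ := hfP (i + 1)
  have hd : P (i + 1) - P i ≠ 0 := fun h0 =>
    fin_one_ne_zero hn (by simpa using h.simple.injective (sub_eq_zero.1 h0))
  obtain ⟨c, hc⟩ := exists_apply_eq_mul_cross f hd (by rw [map_sub]; linarith)
  refine ⟨-c, ?_, fun k => ?_⟩
  · intro h0
    apply hf0
    ext v
    simp [hc v, neg_eq_zero.1 h0]
  · have := hc (P k - P i)
    rw [map_sub] at this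
    linarith [hfP k]

theorem IsConvex.cross_turn_ne_zero {P : Polygon Plane n} (h : P.IsConvex) (hn : 3 ≤ n)
    (hang : ∀ i : Fin n,
      ∠ (P i) (P (i + 1)) (P (i + 2)) ≠ 0 ∧ ∠ (P i) (P (i + 1)) (P (i + 2)) ≠ Real.pi)
    (i : Fin n) : cross (P (i + 1) - P i) (P (i + 1 + 1) - P (i + 1)) ≠ 0 := by
  have hne : ∀ j : Fin n, P (j + 1) ≠ P j := fun j h0 =>
    fin_one_ne_zero hn (by simpa using h.simple.injective h0)
  have h₁ := hang i
  rw [fin_two_eq, ← add_assoc] at h₁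
  have := cross_ne_zero_of_angle_ne (sub_ne_zero.2 (hne i).symm) (sub_ne_zero.2 (hne (i + 1)))
    h₁.1 h₁.2
  have e : cross (P (i + 1) - P i) (P (i + 1 + 1) - P (i + 1))
      = - cross (P i - P (i + 1)) (P (i + 1 + 1) - P (i + 1)) := by
    simp [cross]; ring
  rw [e]
  exact neg_ne_zero.2 this

/-- A convex polygon lies on the same side of all its sides. -/
theorem IsConvex.exists_orientation {P : Polygon Plane n} (h : P.IsConvex) (hn : 3 ≤ n)
    (hturn : ∀ i, cross (P (i + 1) - P i) (P (i + 1 + 1) - P (i + 1)) ≠ 0) :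
    ∃ ε : ℝ, ε ^ 2 = 1 ∧ ∀ i k, 0 ≤ ε * cross (P (i + 1) - P i) (P k - P i) := by
  choose c hc0 hc using h.exists_cross_nonneg hn
  -- Testing side `i` on vertex `i + 2` and side `i + 1` on vertex `i` yields the same nonzero
  -- determinant, so the two signs agree.
  have hstep : ∀ i, 0 < c i * c (i + 1) := by
    intro i
    have h₁ := hc i (i + 1 + 1)
    have h₂ := hc (i + 1) i
    have e₁ : cross (P (i + 1) - P i) (P (i + 1 + 1) - P i)
        = cross (P (i + 1) - P i) (P (i + 1 + 1) - P (i + 1)) := by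
      simp [cross]; ring
    have e₂ : cross (P (i + 1 + 1) - P (i + 1)) (P i - P (i + 1))
        = cross (P (i + 1) - P i) (P (i + 1 + 1) - P (i + 1)) := by
      simp [cross]; ring
    rw [e₁] at h₁
    rw [e₂] at h₂
    have hd := hturn i
    set d := cross (P (i + 1) - P i) (P (i + 1 + 1) - P (i + 1))
    refine lt_of_le_of_ne ?_ (mul_ne_zero (hc0 _) (hc0 _)).symm
    have hd2 : 0 < d ^ 2 := by positivity
    have : 0 ≤ c i * c (i + 1) * d ^ 2 := by nlinarith [mul_nonneg h₁ h₂]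
    exact nonneg_of_mul_nonneg_left this hd2
  have hall : ∀ j : ℕ, 0 < c 0 * c (Fin.ofNat n j) := by
    intro j
    induction j with
    | zero =>
      have : Fin.ofNat n 0 = 0 := rfl
      rw [this]
      exact mul_self_pos.2 (hc0 0)
    | succ j ih =>
      rw [fin_ofNat_succ]
      have h₁ := hstep (Fin.ofNat n j)
      have h₂ : 0 < c (Fin.ofNat n j) ^ 2 := by have := hc0 (Fin.ofNat n j); positivity
      have := mul_pos ih h₁
      refine (pos_iff_pos_of_mul_pos (a := c (Fin.ofNat n j) ^ 2) ?_).1 h₂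
      linarith
  have hall' : ∀ i, 0 < c 0 * c i := fun i => by
    have := hall i
    rwa [show Fin.ofNat n (i : ℕ) = i from Fin.ext (by simp)] at this
  rcases lt_or_gt_of_ne (hc0 0) with h₀ | h₀
  · refine ⟨-1, by norm_num, fun i k => ?_⟩
    have h₁ : c i < 0 := by
      by_contra! hcon
      exact absurd (hall' i) (not_lt.2 (mul_nonpos_of_nonpos_of_nonneg h₀.le hcon))
    have := hc i k
    have := nonpos_of_mul_nonneg_right this h₁
    linarith
  · refine ⟨1, by norm_num, fun i k => ?_⟩
    have h₁ : 0 < c i := pos_of_mul_pos_right (hall' i) h₀.le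
    rw [one_mul]
    exact nonneg_of_mul_nonneg_right (hc i k) h₁

/-- The vertices of a polygon, relative to the special vertex and indexed periodically. -/
def chain (P : Polygon Plane n) (j : ℕ) : Plane := P (Fin.ofNat n j) - P 0

theorem chain_succ_sub (P : Polygon Plane n) (j : ℕ) :
    P.chain (j + 1) - P.chain j = P (Fin.ofNat n j + 1) - P (Fin.ofNat n j) := by
  rw [chain, chain, fin_ofNat_succ, sub_sub_sub_cancel_right]

theorem exists_isConvexChain {P : Polygon Plane n} (hA : P.IsArithmetic) (hC : P.IsConvex) :
    ∃ (a : ℕ) (ε : ℝ), IsConvexChain P.chain n a ε := by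
  have hn := hA.three_le
  obtain ⟨a, ha⟩ := hA.consecutive
  have hturn := hC.cross_turn_ne_zero hn hA.nondegenerate
  obtain ⟨ε, hε, hcross⟩ := hC.exists_orientation hn hturn
  refine ⟨a, ε, hn, hε, ?_, ?_, ?_, ?_, ?_, ?_, ?_, ?_⟩
  · exact sub_self _
  · have : Fin.ofNat n n = 0 := Fin.ext (by simp)
    rw [chain, this, sub_self]
  · intro j hj hjn h0
    have := congrArg Fin.val (hC.simple.injective (sub_eq_zero.1 h0))
    rw [Fin.val_zero, Fin.val_ofNat, Nat.mod_eq_of_lt hjn] at this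
    omega
  · intro j hj
    have := ha (Fin.ofNat n j)
    rw [Fin.val_ofNat, Nat.mod_eq_of_lt hj] at this
    rw [chain_succ_sub, ← this, sideLength, dist_comm, dist_eq_norm]
  · intro j _
    have := hA.perpendicular.inner (Fin.ofNat n j)
    rwa [chain_succ_sub, chain, chain, fin_ofNat_succ]
  · intro j
    rw [chain_succ_sub, chain_succ_sub P (j + 1), fin_ofNat_succ]
    exact hturn _
  · intro j
    -- That `O` lies on the inner side of side `j` fixes the orientation of its triangle with `O`.
    have := hcross (Fin.ofNat n j) 0
    have e : cross (P.chain j) (P.chain (j + 1))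
        = cross (P (Fin.ofNat n j + 1) - P (Fin.ofNat n j)) (P 0 - P (Fin.ofNat n j)) := by
      rw [chain, chain, fin_ofNat_succ]
      simp only [cross, PiLp.sub_apply]
      ring
    rwa [e]
  · intro j
    have := hcross 0 (Fin.ofNat n j)
    have h₁ : Fin.ofNat n 1 = 0 + 1 := fin_ofNat_succ 0
    rwa [← h₁] at this

end Polygon

/-! ### Reconstructing the polygon from its chain -/

namespace IsConvexChain

variable {q : ℕ → Plane} {n a : ℕ} {ε : ℝ}

theorem norm_one (h : IsConvexChain q n a ε) : ‖q 1‖ = a + 1 := by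
  have := h.norm_side 0 (by have := h.three_le; omega)
  rw [h.first, sub_zero] at this
  simpa using this

theorem norm_eq_sqrt {m : ℕ} (h : IsConvexChain q n a ε) (hmn : m ≤ n)
    (hf : ∀ j < m, ⟪q j, q (j + 1) - q j⟫ = 0) (j : ℕ) (hj : j ≤ m) :
    ‖q j‖ = √(∑ i ∈ Finset.range j, ((a : ℝ) + 1 + i) ^ 2) := by
  rw [← h.norm_sq_first hmn hf j hj, Real.sqrt_sq (norm_nonneg _)]

end IsConvexChain

namespace Polygon

theorem rigidEquiv_triangle345 [NeZero 3] {P : Polygon Plane 3} {ε : ℝ}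
    (h : IsConvexChain P.chain 3 2 ε)
    (hf : ∀ j < 2, ⟪P.chain j, P.chain (j + 1) - P.chain j⟫ = 0) :
    P.RigidEquiv triangle345 := by
  have hn₁ : ‖P.chain 1‖ = 3 := by rw [h.norm_one]; norm_num
  have hX₁ : ⟪P.chain 1, P.chain 1⟫ = 9 := by
    rw [real_inner_self_eq_norm_sq, hn₁]; norm_num
  obtain ⟨hX₂, hY₂⟩ := h.first_step le_rfl (by norm_num) (hf 1 (by norm_num))
  rw [hX₁, hn₁, cross_self] at hX₂ hY₂
  norm_num at hX₂ hY₂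
  refine rigidEquiv_of_isometryEquiv (frameIsometry (P 0) ((1 / 3 : ℝ) • P.chain 1) ε
    (by rw [norm_smul, hn₁]; norm_num) h.sign) fun i => ?_
  have key : ∀ v : Plane, cross ((1 / 3 : ℝ) • P.chain 1) v = 1 / 3 * cross (P.chain 1) v :=
    fun v => by simp [cross]; ring
  simp only [frameIsometry, IsometryEquiv.coe_mk, Equiv.coe_fn_mk, key, real_inner_smul_left]
  fin_cases i
  · apply ext_coord <;> simp [triangle345, cross]
  · change !₂[1 / 3 * ⟪P.chain 1, P.chain 1⟫, ε * (1 / 3 * cross (P.chain 1) (P.chain 1))] = _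
    rw [hX₁, cross_self]
    apply ext_coord <;> simp [triangle345]
    norm_num
  · change !₂[1 / 3 * ⟪P.chain 1, P.chain 2⟫, ε * (1 / 3 * cross (P.chain 1) (P.chain 2))] = _
    rw [hX₂, mul_left_comm, hY₂]
    apply ext_coord <;> simp [triangle345] <;> norm_num

/-- In the frame along the first side, with orientation `ε`, two steps of the first arm and one of
the second compute every remaining vertex; both orientations give the same coordinates. -/
theorem rigidEquiv_pentagon [NeZero 5] {P : Polygon Plane 5} {ε : ℝ}
    (h : IsConvexChain P.chain 5 9 ε)
    (hf : ∀ j < 3, ⟪P.chain j, P.chain (j + 1) - P.chain j⟫ = 0)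
    (hs : ∀ j, 3 ≤ j → j < 5 → ⟪P.chain (j + 1), P.chain (j + 1) - P.chain j⟫ = 0) :
    P.RigidEquiv pentagon := by
  have hn₁ : ‖P.chain 1‖ = 10 := by rw [h.norm_one]; norm_num
  have hn₂ : ‖P.chain 2‖ = √221 := by
    rw [h.norm_eq_sqrt (by norm_num) hf 2 (by norm_num)]
    norm_num [Finset.sum_range_succ]
  have hn₄ : ‖P.chain 4‖ = 14 := by
    refine (sq_eq_sq₀ (norm_nonneg _) (by norm_num)).1 ?_
    rw [h.norm_sq_second hs 4 (by norm_num) (by norm_num)]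
    norm_num
  have hX₁ : ⟪P.chain 1, P.chain 1⟫ = 100 := by
    rw [real_inner_self_eq_norm_sq, hn₁]; norm_num
  obtain ⟨hX₂, hY₂⟩ := h.first_step (j := 1) (by norm_num) (by norm_num) (hf 1 (by norm_num))
  obtain ⟨hX₃, hY₃⟩ := h.first_step (j := 2) (by norm_num) (by norm_num) (hf 2 (by norm_num))
  obtain ⟨hX₄, hY₄⟩ := h.second_step (j := 3) (by norm_num) (hs 3 (by norm_num) (by norm_num))
  norm_num only [hX₁, hn₁, cross_self, mul_zero] at hX₂ hY₂
  have hs : (12 : ℝ) / √221 = 12 * (√221 / 221) := by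
    have : √221 * √221 = (221 : ℝ) := Real.mul_self_sqrt (by norm_num)
    have : (0 : ℝ) < √221 := by positivity
    field_simp
    linarith
  norm_num only [hn₂, hX₂, hY₂] at hX₃ hY₃
  rw [hs] at hX₃ hY₃
  norm_num only [hn₄, hX₃, hY₃] at hX₄ hY₄
  refine rigidEquiv_of_isometryEquiv (frameIsometry (P 0) ((1 / 10 : ℝ) • P.chain 1) ε
    (by rw [norm_smul, hn₁]; norm_num) h.sign) fun i => ?_
  have key : ∀ v : Plane, cross ((1 / 10 : ℝ) • P.chain 1) v = 1 / 10 * cross (P.chain 1) v :=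
    fun v => by simp [cross]; ring
  simp only [frameIsometry, IsometryEquiv.coe_mk, Equiv.coe_fn_mk, key, real_inner_smul_left,
    mul_left_comm ε]
  fin_cases i
  · apply ext_coord <;> simp [pentagon, cross]
  · change !₂[1 / 10 * ⟪P.chain 1, P.chain 1⟫, 1 / 10 * (ε * cross (P.chain 1) (P.chain 1))] = _
    rw [hX₁, cross_self]
    apply ext_coord <;> simp [pentagon]
    norm_num
  · change !₂[1 / 10 * ⟪P.chain 1, P.chain 2⟫, 1 / 10 * (ε * cross (P.chain 1) (P.chain 2))] = _
    rw [hX₂, hY₂]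
    apply ext_coord <;> simp [pentagon] <;> norm_num
  · change !₂[1 / 10 * ⟪P.chain 1, P.chain 3⟫, 1 / 10 * (ε * cross (P.chain 1) (P.chain 3))] = _
    rw [hX₃, hY₃]
    apply ext_coord <;> simp [pentagon] <;> ring
  · change !₂[1 / 10 * ⟪P.chain 1, P.chain 4⟫, 1 / 10 * (ε * cross (P.chain 1) (P.chain 4))] = _
    apply ext_coord <;> simp [pentagon] <;> linarith

end Polygon

theorem theorem1p5 :
    ∃ (T : Polygon Plane 3) (Q : Polygon Plane 5),
      (T.IsArithmetic ∧ T.IsConvex ∧ T.ComesFrom 2 4 5) ∧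
      (Q.IsArithmetic ∧ Q.IsConvex ∧ Q.ComesFrom 9 12 14) ∧
      ¬ T.RigidEquiv Q ∧
      ∀ (n : ℕ) [NeZero n] (P : Polygon Plane n), P.IsArithmetic → P.IsConvex →
        P.RigidEquiv T ∨ P.RigidEquiv Q := by
  refine ⟨Polygon.triangle345, Polygon.pentagon,
    ⟨Polygon.triangle345_comesFrom.isArithmetic Polygon.triangle345_isStrictlyLeft,
      Polygon.triangle345_isStrictlyLeft.isConvex (by norm_num), Polygon.triangle345_comesFrom⟩,
    ⟨Polygon.pentagon_comesFrom.isArithmetic Polygon.pentagon_isStrictlyLeft,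
      Polygon.pentagon_isStrictlyLeft.isConvex (by norm_num), Polygon.pentagon_comesFrom⟩,
    Polygon.not_triangle345_rigidEquiv_pentagon, fun n _ P hA hC => ?_⟩
  obtain ⟨a, ε, h⟩ := Polygon.exists_isConvexChain hA hC
  obtain ⟨m, hf, hs, ⟨rfl, rfl, rfl⟩ | ⟨rfl, rfl, rfl⟩⟩ := h.classification
  · exact Or.inl (Polygon.rigidEquiv_triangle345 h hf)
  · exact Or.inr (Polygon.rigidEquiv_pentagon h hf hs)
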